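/- Let $\mathcal H=\{(x,v)\in\mathbb R^2: v\ge 0\}$ and let $d_H$ be the Riemannian distance on $\mathcal H$ generated by the metric form $ds^2=v^{-1}(dx^2+dv^2)$ on the open half-plane $\{v>0\}$ (the infimum of the lengths of curves in the open half-plane, whose end points may lie on the boundary $v=0$). For real $\beta,\gamma$ let $L_{\beta,\gamma}=\{(x,v)\in\mathcal H: x=\beta+\gamma v\}$ and $$D_{\beta,\gamma}=\inf\left\{\tfrac12 d_H((0,1),(x,v))^2:(x,v)\in L_{\beta,\gamma}\right\}.$$ For $0<\theta<2\pi$ put $$\psi(\theta)=\frac{\theta-\sin\theta}{1-\cos\theta},\quad A(\theta)=\frac{\theta\cos\frac\theta2-2\sin\frac\theta2}{\theta-\sin\theta},\quad B(\theta)=\frac{1-\cos\theta}{\theta-\sin\theta},\quad \eta(\theta)=\psi(\theta)(1-A(\theta)).$$ The functions $\psi$ and $\eta$ are bijections of $(0,2\pi)$ onto $(0,\infty)$. For $\alpha>0$ put $$\eta_\alpha(\theta)=\frac{\psi(\theta)^2A(\theta)^2}{\alpha-\psi(\theta)}+\psi(\theta),\qquad 0<\theta<\psi^{-1}(\alpha);$$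 this is a bijection of $(0,\psi^{-1}(\alpha))$ onto $(0,\infty)$. Put $\Delta_{\beta,\gamma}(\theta)=A(\theta)^2-(1-\gamma B(\theta))(1-\beta B(\theta))$, $$S^{\pm}_{\beta,\gamma}(\theta)=\frac{A(\theta)\pm\sqrt{\Delta_{\beta,\gamma}(\theta)}}{1-\gamma B(\theta)},\qquad \Lambda^{\pm}_{\beta,\gamma}(\theta)=\frac{\theta^2}{1-\cos\theta}\left(S^{\pm}_{\beta,\gamma}(\theta)^2+1-2S^{\pm}_{\beta,\gamma}(\theta)\cos\tfrac\theta2\right)$$ where $\Delta_{\beta,\gamma}(\theta)\ge0$ and $\gamma B(\theta)\ne1$. At $\theta=\psi^{-1}(\gamma)$ (the point where $\gamma B(\theta)=1$), $S^+_{\beta,\gamma}$ and $\Lambda^+_{\beta,\gamma}$ denote the limits from the left, which exist, with $S^{+}_{\beta,\gamma}(\theta)=\frac{1-\beta B(\theta)}{2A(\theta)}$ there; and $\Lambda^-_{0,\gamma}(0)=\lim_{\theta\downarrow0}\Lambda^-_{0,\gamma}(\theta)=2$. Then the following hold. All intervals below are non-empty, and $\Delta_{\beta,\gamma}\ge0$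 at all their points (other than $\theta=0$ in part 3). 1) If $\beta>0$, then $$D_{\beta,\beta}=\min\left\{\inf_{\theta\in[\eta^{-1}(\beta),\psi^{-1}(\beta)]}\Lambda^{+}_{\beta,\beta}(\theta),\ \inf_{\theta\in[\eta^{-1}(\beta),\psi^{-1}(\beta))}\Lambda^{-}_{\beta,\beta}(\theta)\right\}.$$ 2) If $\gamma>\beta>0$, then $$D_{\beta,\gamma}=\min\left\{\inf_{\theta\in[\eta_\gamma^{-1}(\beta),\psi^{-1}(\beta)]}\Lambda^{+}_{\beta,\gamma}(\theta),\ \inf_{\theta\in[\eta_\gamma^{-1}(\beta),\psi^{-1}(\gamma))}\Lambda^{-}_{\beta,\gamma}(\theta)\right\}.$$ 3) If $\gamma>0$, then $$D_{0,\gamma}=\inf_{\theta\in[0,\psi^{-1}(\gamma))}\Lambda^{-}_{0,\gamma}(\theta).$$ 4) If $\beta>\gamma>0$, then $$D_{\beta,\gamma}=\min\left\{\inf_{\theta\in[\eta_\beta^{-1}(\gamma),\psi^{-1}(\beta)]}\Lambda^{+}_{\beta,\gamma}(\theta),\ \inf_{\theta\in[\eta_\beta^{-1}(\gamma),\psi^{-1}(\gamma))}\Lambda^{-}_{\beta,\gamma}(\theta)\right\}.$$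 -/

import Mathlib

open Set Filter Topology MeasureTheory

noncomputable section

namespace Heston

/-- `(x, v)` is a parametrized curve from `p` to `q` in the closed half-plane `{v ≥ 0}`: continuous
on `[0, 1]`, and on `(0, 1)` continuously differentiable with values in the open half-plane, where
the metric form `v⁻¹ (dx² + dv²)` lives. Only the end points may lie on the boundary `v = 0`. -/
structure IsCurve (p q : ℝ × ℝ) (x v : ℝ → ℝ) : Prop where
  continuousOn_x : ContinuousOn x (Icc 0 1)
  continuousOn_v : ContinuousOn v (Icc 0 1)
  contDiffOn_x : ContDiffOn ℝ 1 x (Ioo 0 1)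
  contDiffOn_v : ContDiffOn ℝ 1 v (Ioo 0 1)
  pos : ∀ t ∈ Ioo (0 : ℝ) 1, 0 < v t
  start : (x 0, v 0) = p
  finish : (x 1, v 1) = q

/-- The length of a curve for the Riemannian metric `ds² = v⁻¹ (dx² + dv²)`. -/
def length (x v : ℝ → ℝ) : ENNReal :=
  ∫⁻ t in Ioo (0 : ℝ) 1, ENNReal.ofReal (√((deriv x t ^ 2 + deriv v t ^ 2) / v t))

/-- The Riemannian distance on the closed half-plane, as an extended number: the infimum of the
lengths of the curves joining the two points. -/
def edist (p q : ℝ × ℝ) : ENNReal :=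
  ⨅ (x : ℝ → ℝ) (v : ℝ → ℝ) (_ : IsCurve p q x v), length x v

/-- The Heston distance `d_H` (finite for any two points of the closed half-plane). -/
def dist (p q : ℝ × ℝ) : ℝ := (edist p q).toReal

/-- The line `L_{β,γ} = {(x, v) : x = β + γ v, v ≥ 0}`. -/
def line (β γ : ℝ) : Set (ℝ × ℝ) := {p | 0 ≤ p.2 ∧ p.1 = β + γ * p.2}

/-- `D_{β,γ} = inf {d_H((0,1),(x,v))² / 2 : (x,v) ∈ L_{β,γ}}`. -/
def D (β γ : ℝ) : ℝ := sInf ((fun p => dist (0, 1) p ^ 2 / 2) '' line β γ)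

/-- `ψ`. -/
def psi (θ : ℝ) : ℝ := (θ - Real.sin θ) / (1 - Real.cos θ)

/-- `A`. -/
def A (θ : ℝ) : ℝ := (θ * Real.cos (θ / 2) - 2 * Real.sin (θ / 2)) / (θ - Real.sin θ)

/-- `B`. -/
def B (θ : ℝ) : ℝ := (1 - Real.cos θ) / (θ - Real.sin θ)

/-- `η`. -/
def eta (θ : ℝ) : ℝ := psi θ * (1 - A θ)

/-- `η_α`, used for `0 < θ < ψ⁻¹(α)`. -/
def etaSub (α θ : ℝ) : ℝ := psi θ ^ 2 * A θ ^ 2 / (α - psi θ) + psi θ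

/-- The inverse of `ψ : (0, 2π) → (0, ∞)`. -/
def psiInv : ℝ → ℝ := Function.invFunOn psi (Ioo 0 (2 * Real.pi))

/-- The inverse of `η : (0, 2π) → (0, ∞)`. -/
def etaInv : ℝ → ℝ := Function.invFunOn eta (Ioo 0 (2 * Real.pi))

/-- The inverse of `η_α : (0, ψ⁻¹(α)) → (0, ∞)`. -/
def etaSubInv (α : ℝ) : ℝ → ℝ := Function.invFunOn (etaSub α) (Ioo 0 (psiInv α))

/-- The expression under the square root in `S^±_{β,γ}`. -/
def disc (β γ θ : ℝ) : ℝ := A θ ^ 2 - (1 - γ * B θ) * (1 - β * B θ)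

open Classical in
/-- `S⁺_{β,γ}`; where `1 - γ B(θ) = 0`, that is at `θ = ψ⁻¹(γ)`, the value is the limit from the
left, `S_β(θ) = (1 - β B(θ)) / (2 A(θ))`. -/
def SPlus (β γ θ : ℝ) : ℝ :=
  if 1 - γ * B θ = 0 then (1 - β * B θ) / (2 * A θ)
  else (A θ + √(disc β γ θ)) / (1 - γ * B θ)

/-- `S⁻_{β,γ}`, used only where `1 - γ B(θ) ≠ 0`. -/
def SMinus (β γ θ : ℝ) : ℝ := (A θ - √(disc β γ θ)) / (1 - γ * B θ)

/-- `Λ⁺_{β,γ}`, used only for `0 < θ < 2π`. -/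
def LambdaPlus (β γ θ : ℝ) : ℝ :=
  θ ^ 2 / (1 - Real.cos θ) * (SPlus β γ θ ^ 2 + 1 - 2 * SPlus β γ θ * Real.cos (θ / 2))

open Classical in
/-- `Λ⁻_{β,γ}`. The point `θ = 0` is used only for `β = 0`, where the expression is `0 / 0` and the
value is its limit as `θ ↓ 0`, the number `2`. -/
def LambdaMinus (β γ θ : ℝ) : ℝ :=
  if θ = 0 then 2
  else θ ^ 2 / (1 - Real.cos θ) * (SMinus β γ θ ^ 2 + 1 - 2 * SMinus β γ θ * Real.cos (θ / 2))

end Heston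

end

/-! The metric `v⁻¹ (dx² + dv²)` is the brachistochrone metric, so its geodesics are cycloids. In the
coordinate `u = √v` a geodesic parametrized on `[0, 1]` satisfies `u'' = -ω² u` and `x' = 2 ω u²`,
where `θ = 2 ω` is the opening angle of the cycloid arc. Integrating, the arc of angle `θ` from
`(0, 1)` to height `S²` ends at the abscissa `ψ(θ) (1 + S²) + 2 χ(θ) S`, with `χ = -ψ A`, and half the
square of its length is `θ² (1 - cos θ)⁻¹ (S² + 1 - 2 S cos (θ / 2))` (`dist_sq_div_two`).

That these arcs are shortest is a calibration argument. The multiplier `2 ω` eliminates `x`: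
`(x' / u)² - 4 ω x' ≥ -4 ω² u²`. What remains is `4 ∫ (u'² - ω² u²)`, which the solution `h` of
`h'' = -ω² h` minimizes for `ω < π`, by completing the square with a solution
`w = -ω tan (ω (t - 1/2))` of the Riccati equation. The bound is used with the time proportional to
(nearly) the arc length of the competing curve, so that energy and squared length agree
(`IsCurve.exists_time`, `IsCurve.sq_ge`, `dist_geodesic`).

Both `ψ` and `χ` are strictly increasing, and `ψ` maps `(0, 2π)` onto `(0, ∞)`; so every point
`(x, S²)` with `x > 0` is reached by an arc of some angle (`exists_angle`). For a point of the line
`x = β + γ v` this says that `S` is a nonnegative root of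
`(1 - γ B) S² - 2 A S + (1 - β B) = 0`. As `A < 0`, the root `S⁺` is admissible exactly when
`1 - β B ≤ 0`, that is `θ ≤ ψ⁻¹(β)`, and `S⁻` exactly when `1 - γ B < 0`, that is `θ < ψ⁻¹(γ)`
(`root_iff`). The lower ends of the intervals come from `Δ ≥ 0`, which reads
`(ψ - γ) (ψ - β) ≤ χ²`. -/

namespace Heston

/-! ### Monotone bijections onto `(0, ∞)` -/

theorem bijOn_Ioi_zero {f : ℝ → ℝ} {b : ℝ} (hb : 0 < b) (hc : ContinuousOn f (Ioo 0 b))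
    (hm : StrictMonoOn f (Ioo 0 b)) (h0 : Tendsto f (𝓝[>] 0) (𝓝 0))
    (h1 : Tendsto f (𝓝[<] b) atTop) : BijOn f (Ioo 0 b) (Ioi 0) := by
  refine ⟨?_, hm.injOn, ?_⟩
  · intro x hx
    have hx2 : x / 2 ∈ Ioo 0 b := ⟨by linarith [hx.1], by linarith [hx.1, hx.2]⟩
    have h2 : f (x / 2) < f x := hm hx2 hx (by linarith [hx.1])
    have h3 : 0 ≤ f (x / 2) := by
      refine le_of_tendsto h0 ?_
      filter_upwards [Ioo_mem_nhdsGT hx2.1] with y hy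
      exact (hm ⟨hy.1, hy.2.trans hx2.2⟩ hx2 hy.2).le
    exact lt_of_le_of_lt h3 h2
  · intro y hy
    have e0 : ∀ᶠ t in 𝓝[>] (0 : ℝ), t ∈ Ioo 0 b ∧ f t < y :=
      (eventually_mem_set.2 (Ioo_mem_nhdsGT hb)).and (h0.eventually_lt_const hy)
    have e1 : ∀ᶠ t in 𝓝[<] b, t ∈ Ioo 0 b ∧ y < f t :=
      (eventually_mem_set.2 (Ioo_mem_nhdsLT hb)).and (h1.eventually_gt_atTop y)
    obtain ⟨p, hp, hpy⟩ := e0.exists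
    obtain ⟨q, hq, hqy⟩ := e1.exists
    exact isPreconnected_Ioo.intermediate_value hp hq hc ⟨hpy.le, hqy.le⟩

/-! ### The functions `ψ` and `χ` -/

/-- The function `χ = -ψ A`, written in terms of the half angle `θ / 2`. It is the coefficient of
`2 S` in the abscissa `ψ (1 + S²) + 2 χ S` of the end point of a geodesic. -/
noncomputable def chi (θ : ℝ) : ℝ :=
  (Real.sin (θ / 2) - θ / 2 * Real.cos (θ / 2)) / Real.sin (θ / 2) ^ 2

theorem one_sub_cos_eq (θ : ℝ) : 1 - Real.cos θ = 2 * Real.sin (θ / 2) ^ 2 := by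
  have h := Real.cos_two_mul (θ / 2)
  rw [mul_div_cancel₀ θ two_ne_zero] at h
  nlinarith [Real.sin_sq_add_cos_sq (θ / 2)]

theorem sub_sin_eq (θ : ℝ) :
    θ - Real.sin θ = 2 * (θ / 2 - Real.sin (θ / 2) * Real.cos (θ / 2)) := by
  have h := Real.sin_two_mul (θ / 2)
  rw [mul_div_cancel₀ θ two_ne_zero] at h
  rw [h]; ring

theorem psi_eq (θ : ℝ) :
    psi θ = (θ / 2 - Real.sin (θ / 2) * Real.cos (θ / 2)) / Real.sin (θ / 2) ^ 2 := by
  rw [psi, one_sub_cos_eq, sub_sin_eq, mul_div_mul_left _ _ two_ne_zero]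

theorem sin_half_pos {θ : ℝ} (h : θ ∈ Ioo 0 (2 * Real.pi)) : 0 < Real.sin (θ / 2) :=
  Real.sin_pos_of_pos_of_lt_pi (by linarith [h.1]) (by linarith [h.2])

theorem mul_cos_lt_sin {δ : ℝ} (h0 : 0 < δ) (h1 : δ < Real.pi) : δ * Real.cos δ < Real.sin δ := by
  rcases le_or_gt (Real.pi / 2) δ with h | h
  · have : Real.cos δ ≤ 0 := Real.cos_nonpos_of_pi_div_two_le_of_le h (by linarith)
    nlinarith [Real.sin_pos_of_pos_of_lt_pi h0 h1]
  · have hc : 0 < Real.cos δ := Real.cos_pos_of_mem_Ioo ⟨by linarith, h⟩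
    have := Real.lt_tan h0 h
    rwa [Real.tan_eq_sin_div_cos, lt_div_iff₀ hc] at this

theorem sub_sin_pos {θ : ℝ} (h : 0 < θ) : 0 < θ - Real.sin θ := sub_pos.2 (Real.sin_lt h)

theorem one_sub_cos_pos {θ : ℝ} (h : θ ∈ Ioo 0 (2 * Real.pi)) : 0 < 1 - Real.cos θ := by
  rw [one_sub_cos_eq]; have := sin_half_pos h; positivity

theorem psi_pos {θ : ℝ} (h : θ ∈ Ioo 0 (2 * Real.pi)) : 0 < psi θ :=
  div_pos (sub_sin_pos h.1) (one_sub_cos_pos h)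

theorem chi_pos {θ : ℝ} (h : θ ∈ Ioo 0 (2 * Real.pi)) : 0 < chi θ := by
  have := sin_half_pos h
  have := mul_cos_lt_sin (δ := θ / 2) (by linarith [h.1]) (by linarith [h.2])
  exact div_pos (by linarith) (by positivity)

theorem psi_mul_A {θ : ℝ} (h : θ ∈ Ioo 0 (2 * Real.pi)) : psi θ * A θ = -chi θ := by
  have h1 := (sub_sin_pos h.1).ne'
  rw [psi, A, chi, one_sub_cos_eq, div_mul_div_cancel₀' h1]
  have := (sin_half_pos h).ne'
  field_simp
  ring

theorem psi_mul_B {θ : ℝ} (h : θ ∈ Ioo 0 (2 * Real.pi)) : psi θ * B θ = 1 := by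
  have h1 := (sub_sin_pos h.1).ne'
  have h2 := (one_sub_cos_pos h).ne'
  rw [psi, B]; field_simp

theorem hasDerivAt_psi {θ : ℝ} (h : θ ∈ Ioo 0 (2 * Real.pi)) :
    HasDerivAt psi ((Real.sin (θ / 2) - θ / 2 * Real.cos (θ / 2)) / Real.sin (θ / 2) ^ 3) θ := by
  have hs := (sin_half_pos h).ne'
  have hd : HasDerivAt (fun t : ℝ => t / 2) (1 / 2) θ := (hasDerivAt_id θ).div_const 2
  have h1 := hd.sin
  have h2 := hd.cos
  have h3 := (hd.sub (h1.mul h2)).div (h1.pow 2) (pow_ne_zero 2 hs)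
  rw [funext psi_eq]
  refine h3.congr_deriv ?_
  have e := Real.sin_sq_add_cos_sq (θ / 2)
  simp only [Pi.mul_apply, Pi.sub_apply, Pi.pow_apply, Nat.cast_ofNat,
    Nat.add_one_sub_one, pow_one]
  field_simp
  linear_combination Real.sin (θ / 2) * e

theorem hasDerivAt_chi {θ : ℝ} (h : θ ∈ Ioo 0 (2 * Real.pi)) :
    HasDerivAt chi ((θ / 2 * (1 + Real.cos (θ / 2) ^ 2) -
      2 * Real.sin (θ / 2) * Real.cos (θ / 2)) / (2 * Real.sin (θ / 2) ^ 3)) θ := by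
  have hs := (sin_half_pos h).ne'
  have hd : HasDerivAt (fun t : ℝ => t / 2) (1 / 2) θ := (hasDerivAt_id θ).div_const 2
  have h1 := hd.sin
  have h2 := hd.cos
  have h3 := (h1.sub (hd.mul h2)).div (h1.pow 2) (pow_ne_zero 2 hs)
  refine h3.congr_deriv ?_
  have e := Real.sin_sq_add_cos_sq (θ / 2)
  simp only [Pi.mul_apply, Pi.sub_apply, Pi.pow_apply, Nat.cast_ofNat,
    Nat.add_one_sub_one, pow_one]
  field_simp
  linear_combination θ * e

theorem continuousOn_psi : ContinuousOn psi (Ioo 0 (2 * Real.pi)) := fun _ h =>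
  (hasDerivAt_psi h).continuousAt.continuousWithinAt

theorem continuousOn_chi : ContinuousOn chi (Ioo 0 (2 * Real.pi)) := fun _ h =>
  (hasDerivAt_chi h).continuousAt.continuousWithinAt

theorem strictMonoOn_psi : StrictMonoOn psi (Ioo 0 (2 * Real.pi)) := by
  refine strictMonoOn_of_deriv_pos (convex_Ioo _ _) continuousOn_psi fun θ h => ?_
  rw [interior_Ioo] at h
  rw [(hasDerivAt_psi h).deriv]
  have := sin_half_pos h
  have := mul_cos_lt_sin (δ := θ / 2) (by linarith [h.1]) (by linarith [h.2])
  exact div_pos (by linarith) (by positivity)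

theorem strictMonoOn_chi : StrictMonoOn chi (Ioo 0 (2 * Real.pi)) := by
  refine strictMonoOn_of_deriv_pos (convex_Ioo _ _) continuousOn_chi fun θ h => ?_
  rw [interior_Ioo] at h
  rw [(hasDerivAt_chi h).deriv]
  have hs := sin_half_pos h
  refine div_pos ?_ (by positivity)
  have h0 : 0 < θ / 2 := by linarith [h.1]
  have h1 : Real.sin (θ / 2) < θ / 2 := Real.sin_lt h0
  rcases le_or_gt (Real.cos (θ / 2)) 0 with hc | hc
  · nlinarith [mul_nonneg hs.le (neg_nonneg.2 hc), mul_nonneg h0.le (sq_nonneg (Real.cos (θ / 2)))]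
  · nlinarith [mul_nonneg h0.le (sq_nonneg (1 - Real.cos (θ / 2))),
      mul_lt_mul_of_pos_right h1 hc]

/-- Since `2 δ / π ≤ sin δ`, a cubic bound on the numerator gives a limit `0` at `0`. -/
theorem tendsto_div_sin_sq_zero {f : ℝ → ℝ} (hf : ∀ θ ∈ Ioo (0 : ℝ) 1, 0 ≤ f θ ∧ f θ ≤ θ ^ 3) :
    Tendsto (fun θ => f θ / Real.sin (θ / 2) ^ 2) (𝓝[>] 0) (𝓝 0) := by
  have hlim : Tendsto (fun θ : ℝ => Real.pi ^ 2 * θ) (𝓝[>] 0) (𝓝 0) := by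
    have : Tendsto (fun θ : ℝ => Real.pi ^ 2 * θ) (𝓝 0) (𝓝 (Real.pi ^ 2 * 0)) :=
      (continuous_const.mul continuous_id).tendsto 0
    rw [mul_zero] at this
    exact this.mono_left nhdsWithin_le_nhds
  have hpi := Real.pi_pos
  refine tendsto_of_tendsto_of_tendsto_of_le_of_le' tendsto_const_nhds hlim ?_ ?_
  · filter_upwards [Ioo_mem_nhdsGT one_pos] with θ h
    exact div_nonneg (hf θ h).1 (sq_nonneg _)
  · filter_upwards [Ioo_mem_nhdsGT one_pos] with θ h
    have h2 : 2 / Real.pi * (θ / 2) ≤ Real.sin (θ / 2) :=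
      Real.mul_le_sin (by linarith [h.1]) (by linarith [h.2, Real.pi_gt_three])
    have h3 : θ / Real.pi ≤ Real.sin (θ / 2) := by
      calc θ / Real.pi = 2 / Real.pi * (θ / 2) := by ring
        _ ≤ _ := h2
    have h4 : 0 < θ / Real.pi := div_pos h.1 hpi
    have h5 : (θ / Real.pi) ^ 2 ≤ Real.sin (θ / 2) ^ 2 := by gcongr
    rw [div_le_iff₀ (lt_of_lt_of_le (by positivity) h5)]
    calc f θ ≤ θ ^ 3 := (hf θ h).2
      _ = Real.pi ^ 2 * θ * (θ / Real.pi) ^ 2 := by field_simp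
      _ ≤ _ := by have := h.1; gcongr

theorem tendsto_psi_zero : Tendsto psi (𝓝[>] 0) (𝓝 0) := by
  rw [funext psi_eq]
  refine tendsto_div_sin_sq_zero fun θ h => ?_
  have h0 : 0 < θ / 2 := by linarith [h.1]
  have h1 := Real.sin_gt_sub_cube h0
  have h2 := Real.one_sub_sq_div_two_le_cos (x := θ / 2)
  have h3 := Real.sin_lt h0
  have h4 : 0 < Real.sin (θ / 2) :=
    Real.sin_pos_of_pos_of_lt_pi h0 (by linarith [h.2, Real.pi_gt_three])
  have h5 := Real.cos_le_one (θ / 2)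
  constructor
  · nlinarith
  · have h6 : Real.sin (θ / 2) * (1 - Real.cos (θ / 2)) ≤ θ / 2 * ((θ / 2) ^ 2 / 2) := by
      gcongr
      linarith
    have h7 : 0 < θ ^ 3 := by have := h.1; positivity
    nlinarith

theorem tendsto_chi_zero : Tendsto chi (𝓝[>] 0) (𝓝 0) := by
  refine tendsto_div_sin_sq_zero fun θ h => ?_
  have h0 : 0 < θ / 2 := by linarith [h.1]
  have h2 := Real.one_sub_sq_div_two_le_cos (x := θ / 2)
  have h3 := Real.sin_lt h0
  have h4 := mul_cos_lt_sin h0 (by linarith [h.2, Real.pi_gt_three])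
  have h7 : 0 < θ ^ 3 := by have := h.1; positivity
  constructor
  · linarith
  · nlinarith

theorem tendsto_div_atTop {α : Type*} {l : Filter α} {f g : α → ℝ} {c : ℝ} (hc : 0 < c)
    (hf : Tendsto f l (𝓝 c)) (hg : Tendsto g l (𝓝 0)) (hpos : ∀ᶠ t in l, 0 < g t) :
    Tendsto (fun t => f t / g t) l atTop := by
  simp only [div_eq_mul_inv]
  exact hf.pos_mul_atTop hc
    (tendsto_inv_nhdsGT_zero.comp (tendsto_nhdsWithin_iff.2 ⟨hg, hpos⟩))

theorem tendsto_sin_half_sq :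
    Tendsto (fun θ : ℝ => Real.sin (θ / 2) ^ 2) (𝓝[<] (2 * Real.pi)) (𝓝 0) := by
  have : Tendsto (fun θ : ℝ => Real.sin (θ / 2) ^ 2) (𝓝 (2 * Real.pi))
      (𝓝 (Real.sin (2 * Real.pi / 2) ^ 2)) := Continuous.tendsto (by fun_prop) _
  rw [mul_div_cancel_left₀ _ two_ne_zero, Real.sin_pi, zero_pow two_ne_zero] at this
  exact this.mono_left nhdsWithin_le_nhds

theorem eventually_sin_half_sq_pos :
    ∀ᶠ θ in 𝓝[<] (2 * Real.pi), 0 < Real.sin (θ / 2) ^ 2 := by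
  filter_upwards [Ioo_mem_nhdsLT Real.two_pi_pos] with θ h
  have := sin_half_pos h
  positivity

theorem tendsto_psi_atTop : Tendsto psi (𝓝[<] (2 * Real.pi)) atTop := by
  rw [funext psi_eq]
  refine tendsto_div_atTop Real.pi_pos ?_ tendsto_sin_half_sq eventually_sin_half_sq_pos
  have : Tendsto (fun θ : ℝ => θ / 2 - Real.sin (θ / 2) * Real.cos (θ / 2)) (𝓝 (2 * Real.pi))
      (𝓝 (2 * Real.pi / 2 - Real.sin (2 * Real.pi / 2) * Real.cos (2 * Real.pi / 2))) :=
    Continuous.tendsto (by fun_prop) _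
  rw [mul_div_cancel_left₀ _ two_ne_zero, Real.sin_pi, zero_mul, sub_zero] at this
  exact this.mono_left nhdsWithin_le_nhds

theorem bijOn_psi : BijOn psi (Ioo 0 (2 * Real.pi)) (Ioi 0) :=
  bijOn_Ioi_zero Real.two_pi_pos continuousOn_psi strictMonoOn_psi tendsto_psi_zero
    tendsto_psi_atTop

/-- Every combination `a ψ + b χ` with `a > 0`, `b ≥ 0` is a bijection onto `(0, ∞)`: this covers
`η = ψ + χ` as well as the abscissa of the end point of a geodesic as a function of the angle. -/
theorem bijOn_psi_add_chi {a b : ℝ} (ha : 0 < a) (hb : 0 ≤ b) :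
    BijOn (fun θ => a * psi θ + b * chi θ) (Ioo 0 (2 * Real.pi)) (Ioi 0) := by
  refine bijOn_Ioi_zero Real.two_pi_pos
    ((continuousOn_const.mul continuousOn_psi).add (continuousOn_const.mul continuousOn_chi))
    ?_ ?_ ?_
  · intro x hx y hy hxy
    have h1 := strictMonoOn_psi hx hy hxy
    have h2 := strictMonoOn_chi hx hy hxy
    exact add_lt_add_of_lt_of_le (mul_lt_mul_of_pos_left h1 ha)
      (mul_le_mul_of_nonneg_left h2.le hb)
  · simpa using (tendsto_psi_zero.const_mul a).add (tendsto_chi_zero.const_mul b)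
  · refine tendsto_atTop_mono' _ ?_ (tendsto_psi_atTop.const_mul_atTop ha)
    filter_upwards [Ioo_mem_nhdsLT Real.two_pi_pos] with θ h
    have := chi_pos h
    nlinarith [mul_nonneg hb this.le]

theorem eta_eq {θ : ℝ} (h : θ ∈ Ioo 0 (2 * Real.pi)) : eta θ = psi θ + chi θ := by
  rw [eta, mul_sub, psi_mul_A h]; ring

theorem bijOn_eta : BijOn eta (Ioo 0 (2 * Real.pi)) (Ioi 0) :=
  (bijOn_psi_add_chi one_pos zero_le_one).congr fun θ h => by
    simp only [one_mul]; exact (eta_eq h).symm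

theorem psiInv_mem {α : ℝ} (h : 0 < α) : psiInv α ∈ Ioo 0 (2 * Real.pi) :=
  Function.invFunOn_mem (bijOn_psi.surjOn h)

theorem psi_psiInv {α : ℝ} (h : 0 < α) : psi (psiInv α) = α :=
  Function.invFunOn_eq (bijOn_psi.surjOn h)

theorem lt_psiInv_iff {α θ : ℝ} (hα : 0 < α) (h : θ ∈ Ioo 0 (2 * Real.pi)) :
    θ < psiInv α ↔ psi θ < α := by
  rw [← strictMonoOn_psi.lt_iff_lt h (psiInv_mem hα), psi_psiInv hα]

theorem le_psiInv_iff {α θ : ℝ} (hα : 0 < α) (h : θ ∈ Ioo 0 (2 * Real.pi)) :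
    θ ≤ psiInv α ↔ psi θ ≤ α := by
  rw [← strictMonoOn_psi.le_iff_le h (psiInv_mem hα), psi_psiInv hα]

theorem psiInv_lt_psiInv {α β : ℝ} (hα : 0 < α) (h : α < β) : psiInv α < psiInv β := by
  rw [lt_psiInv_iff (hα.trans h) (psiInv_mem hα), psi_psiInv hα]; exact h

theorem Ioo_psiInv_subset {α : ℝ} (h : 0 < α) : Ioo 0 (psiInv α) ⊆ Ioo 0 (2 * Real.pi) :=
  Ioo_subset_Ioo_right (psiInv_mem h).2.le

theorem etaSub_eq {α θ : ℝ} (h : θ ∈ Ioo 0 (2 * Real.pi)) :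
    etaSub α θ = chi θ ^ 2 / (α - psi θ) + psi θ := by
  rw [etaSub, ← mul_pow, psi_mul_A h, neg_sq]

theorem strictMonoOn_etaSub {α : ℝ} (hα : 0 < α) :
    StrictMonoOn (etaSub α) (Ioo 0 (psiInv α)) := by
  intro x hx y hy hxy
  have hx' := Ioo_psiInv_subset hα hx
  have hy' := Ioo_psiInv_subset hα hy
  rw [etaSub_eq hx', etaSub_eq hy']
  have h1 := strictMonoOn_psi hx' hy' hxy
  have h2 := strictMonoOn_chi hx' hy' hxy
  have h3 := (lt_psiInv_iff hα hy').1 hy.2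
  have h4 := chi_pos hx'
  refine add_lt_add_of_le_of_lt ?_ h1
  gcongr

theorem bijOn_etaSub {α : ℝ} (hα : 0 < α) :
    BijOn (etaSub α) (Ioo 0 (psiInv α)) (Ioi 0) := by
  have hsub := Ioo_psiInv_subset hα
  have hp := psiInv_mem hα
  have hpsi : Tendsto psi (𝓝[<] (psiInv α)) (𝓝 α) := by
    have := (hasDerivAt_psi hp).continuousAt.tendsto
    rw [psi_psiInv hα] at this
    exact this.mono_left nhdsWithin_le_nhds
  have hchi : Tendsto chi (𝓝[<] (psiInv α)) (𝓝 (chi (psiInv α))) :=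
    (hasDerivAt_chi hp).continuousAt.tendsto.mono_left nhdsWithin_le_nhds
  have hev : ∀ᶠ θ in 𝓝[<] (psiInv α), θ ∈ Ioo 0 (psiInv α) := Ioo_mem_nhdsLT hp.1
  refine bijOn_Ioi_zero hp.1 ?_ (strictMonoOn_etaSub hα) ?_ ?_
  · refine ContinuousOn.congr (f := fun θ => chi θ ^ 2 / (α - psi θ) + psi θ) ?_
      fun θ h => etaSub_eq (hsub h)
    have h1 := continuousOn_psi.mono hsub
    have h2 := continuousOn_chi.mono hsub
    refine ((h2.pow 2).div (continuousOn_const.sub h1) fun θ h => ?_).add h1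
    exact (sub_pos.2 ((lt_psiInv_iff hα (hsub h)).1 h.2)).ne'
  · have h1 : Tendsto (fun θ => chi θ ^ 2 / (α - psi θ) + psi θ) (𝓝[>] 0)
        (𝓝 (0 ^ 2 / (α - 0) + 0)) :=
      ((tendsto_chi_zero.pow 2).div (tendsto_const_nhds.sub tendsto_psi_zero)
        (by simpa using hα.ne')).add tendsto_psi_zero
    simp only [zero_pow two_ne_zero, zero_div, add_zero] at h1
    refine h1.congr' ?_
    filter_upwards [Ioo_mem_nhdsGT Real.two_pi_pos] with θ h
    exact (etaSub_eq h).symm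
  · have hc := chi_pos hp
    have h1 : Tendsto (fun θ => chi θ ^ 2 / (α - psi θ)) (𝓝[<] (psiInv α)) atTop := by
      refine tendsto_div_atTop (pow_pos hc 2) (hchi.pow 2) ?_ ?_
      · simpa using (tendsto_const_nhds (x := α)).sub hpsi
      · filter_upwards [hev] with θ h
        exact sub_pos.2 ((lt_psiInv_iff hα (hsub h)).1 h.2)
    refine tendsto_atTop_mono' _ ?_ h1
    filter_upwards [hev] with θ h
    rw [etaSub_eq (hsub h)]
    linarith [psi_pos (hsub h)]

theorem etaInv_mem {α : ℝ} (h : 0 < α) : etaInv α ∈ Ioo 0 (2 * Real.pi) :=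
  Function.invFunOn_mem (bijOn_eta.surjOn h)

theorem eta_etaInv {α : ℝ} (h : 0 < α) : eta (etaInv α) = α :=
  Function.invFunOn_eq (bijOn_eta.surjOn h)

theorem etaSubInv_mem {α β : ℝ} (hα : 0 < α) (h : 0 < β) :
    etaSubInv α β ∈ Ioo 0 (psiInv α) :=
  Function.invFunOn_mem ((bijOn_etaSub hα).surjOn h)

theorem etaSub_etaSubInv {α β : ℝ} (hα : 0 < α) (h : 0 < β) : etaSub α (etaSubInv α β) = β :=
  Function.invFunOn_eq ((bijOn_etaSub hα).surjOn h)

theorem etaInv_le_iff {α θ : ℝ} (hα : 0 < α) (h : θ ∈ Ioo 0 (2 * Real.pi)) :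
    etaInv α ≤ θ ↔ α ≤ psi θ + chi θ := by
  have hm : StrictMonoOn eta (Ioo 0 (2 * Real.pi)) := fun x hx y hy hxy => by
    rw [eta_eq hx, eta_eq hy]
    exact add_lt_add (strictMonoOn_psi hx hy hxy) (strictMonoOn_chi hx hy hxy)
  rw [← hm.le_iff_le (etaInv_mem hα) h, eta_etaInv hα, eta_eq h]

theorem etaSubInv_le_iff {α β θ : ℝ} (hα : 0 < α) (hβ : 0 < β) (h : θ ∈ Ioo 0 (psiInv α)) :
    etaSubInv α β ≤ θ ↔ β ≤ chi θ ^ 2 / (α - psi θ) + psi θ := by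
  rw [← (strictMonoOn_etaSub hα).le_iff_le (etaSubInv_mem hα hβ) h, etaSub_etaSubInv hα hβ,
    etaSub_eq (Ioo_psiInv_subset hα h)]

theorem etaInv_lt_psiInv {β : ℝ} (hβ : 0 < β) : etaInv β < psiInv β := by
  have h := etaInv_mem hβ
  rw [lt_psiInv_iff hβ h]
  have := eta_etaInv hβ
  rw [eta_eq h] at this
  linarith [chi_pos h]

theorem etaSubInv_lt_psiInv {α β : ℝ} (hα : 0 < α) (hβ : 0 < β) :
    etaSubInv α β < psiInv β := by
  have h := etaSubInv_mem hα hβ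
  have h' := Ioo_psiInv_subset hα h
  rw [lt_psiInv_iff hβ h']
  have := etaSub_etaSubInv hα hβ
  rw [etaSub_eq h'] at this
  have h1 := chi_pos h'
  have h2 := (lt_psiInv_iff hα h').1 h.2
  have : 0 < chi (etaSubInv α β) ^ 2 / (α - psi (etaSubInv α β)) :=
    div_pos (pow_pos h1 2) (by linarith)
  linarith

/-! ### Lengths of curves and calibrations -/

/-- Completing two squares in the coordinates `u = √v`, `y = x' / √v`: here `a = u - h`, the number
`r` is the derivative of the time, and `4 u'² + y²` is the square of the speed of the curve. -/
theorem calibration_deriv_nonneg {ω h k w u u' x' y r L : ℝ} (hr : 0 < r) (hx : x' = y * u)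
    (hs : 4 * u' ^ 2 + y ^ 2 ≤ L ^ 2 * r ^ 2) :
    0 ≤ L ^ 2 * r - (4 * ω * x' + 4 * ((k ^ 2 - ω ^ 2 * h ^ 2) * r +
      2 * (-ω ^ 2 * h * r * (u - h) + k * (u' - k * r)) +
      ((-ω ^ 2 - w ^ 2) * r * (u - h) ^ 2 + w * (2 * (u - h) * (u' - k * r))))) := by
  refine nonneg_of_mul_nonneg_left (b := r) ?_ hr
  have h1 := sq_nonneg (u' - k * r - w * (u - h) * r)
  have h2 := sq_nonneg (y - 2 * ω * u * r)
  rw [hx]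
  linear_combination 4 * h1 + h2 + hs

theorem IsCurve.hasDerivAt {p q : ℝ × ℝ} {x v : ℝ → ℝ} (hc : IsCurve p q x v) {t : ℝ}
    (ht : t ∈ Ioo (0 : ℝ) 1) : HasDerivAt x (deriv x t) t ∧ HasDerivAt v (deriv v t) t :=
  ⟨((hc.contDiffOn_x.differentiableOn one_ne_zero).differentiableAt
      (isOpen_Ioo.mem_nhds ht)).hasDerivAt,
    ((hc.contDiffOn_v.differentiableOn one_ne_zero).differentiableAt
      (isOpen_Ioo.mem_nhds ht)).hasDerivAt⟩

theorem IsCurve.continuousOn_speed {p q : ℝ × ℝ} {x v : ℝ → ℝ} (hc : IsCurve p q x v) :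
    ContinuousOn (fun t => √((deriv x t ^ 2 + deriv v t ^ 2) / v t)) (Ioo 0 1) := by
  have h1 := hc.contDiffOn_x.continuousOn_deriv_of_isOpen isOpen_Ioo le_rfl
  have h2 := hc.contDiffOn_v.continuousOn_deriv_of_isOpen isOpen_Ioo le_rfl
  exact (((h1.pow 2).add (h2.pow 2)).div (hc.continuousOn_v.mono Ioo_subset_Icc_self)
    fun t ht => (hc.pos t ht).ne').sqrt

/-- A curve of length less than `L` has a time function `T` from `0` to `1` whose derivative is
positive and bounds the speed by `L T'`. The surplus of `L` over the length is spread evenly over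
the parameter interval, which makes `T'` positive even where the speed vanishes. -/
theorem IsCurve.exists_time {p q : ℝ × ℝ} {x v : ℝ → ℝ} (hc : IsCurve p q x v) {L : ℝ}
    (hL : length x v < ENNReal.ofReal L) :
    ∃ T r : ℝ → ℝ, ContinuousOn T (Icc 0 1) ∧ T 0 = 0 ∧ T 1 = 1 ∧
      MapsTo T (Icc 0 1) (Icc 0 1) ∧ ∀ s ∈ Ioo (0 : ℝ) 1, HasDerivAt T (r s) s ∧ 0 < r s ∧
        (deriv x s ^ 2 + deriv v s ^ 2) / v s ≤ L ^ 2 * r s ^ 2 := by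
  set σ : ℝ → ℝ := fun t => √((deriv x t ^ 2 + deriv v t ^ 2) / v t) with hσ
  have hcont : ContinuousOn σ (Ioo 0 1) := hc.continuousOn_speed
  have hσ0 : ∀ t, 0 ≤ σ t := fun t => Real.sqrt_nonneg _
  have hL0 : 0 < L := ENNReal.ofReal_pos.1 (lt_of_le_of_lt bot_le hL)
  have hint : IntegrableOn σ (Ioo 0 1) := by
    refine ⟨hcont.aestronglyMeasurable measurableSet_Ioo, ?_⟩
    rw [hasFiniteIntegral_iff_ofReal (Eventually.of_forall hσ0)]
    exact hL.trans ENNReal.ofReal_lt_top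
  have hI : ∫ t in Ioo (0 : ℝ) 1, σ t < L := by
    rw [← ENNReal.ofReal_lt_ofReal_iff hL0,
      ofReal_integral_eq_lintegral_ofReal hint (Eventually.of_forall hσ0)]
    exact hL
  have hii : IntervalIntegrable σ volume 0 1 :=
    (intervalIntegrable_iff_integrableOn_Ioo_of_le zero_le_one).2 hint
  have hI' : ∫ t in (0 : ℝ)..1, σ t = ∫ t in Ioo (0 : ℝ) 1, σ t := by
    rw [intervalIntegral.integral_of_le zero_le_one, integral_Ioc_eq_integral_Ioo]
  set c := L - ∫ t in Ioo (0 : ℝ) 1, σ t with hcdef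
  have hc0 : 0 < c := sub_pos.2 hI
  set T : ℝ → ℝ := fun s => ((∫ t in (0 : ℝ)..s, σ t) + c * s) / L with hT
  have hTc : ContinuousOn T (Icc 0 1) := by
    have h1 := intervalIntegral.continuousOn_primitive_interval' hii left_mem_uIcc
    rw [uIcc_of_le zero_le_one] at h1
    exact (h1.add (continuousOn_const.mul continuousOn_id)).div_const L
  have hTd : ∀ s ∈ Ioo (0 : ℝ) 1, HasDerivAt T ((σ s + c) / L) s := by
    intro s hs
    have h1 : IntervalIntegrable σ volume 0 s :=
      hii.mono_set (by
        rw [uIcc_of_le hs.1.le, uIcc_of_le zero_le_one]; exact Icc_subset_Icc_right hs.2.le)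
    have h2 := intervalIntegral.integral_hasDerivAt_right h1
      (hcont.stronglyMeasurableAtFilter isOpen_Ioo s hs)
      (hcont.continuousAt (isOpen_Ioo.mem_nhds hs))
    have h3 : HasDerivAt (fun s => c * s) c s := by
      simpa using (hasDerivAt_id s).const_mul c
    exact (h2.add h3).div_const L
  have hr : ∀ s, 0 < (σ s + c) / L := fun s =>
    div_pos (add_pos_of_nonneg_of_pos (hσ0 s) hc0) hL0
  have hmono : MonotoneOn T (Icc 0 1) := by
    refine monotoneOn_of_deriv_nonneg (convex_Icc 0 1) hTc ?_ ?_ <;> rw [interior_Icc]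
    · exact fun s hs => (hTd s hs).differentiableAt.differentiableWithinAt
    · intro s hs
      rw [(hTd s hs).deriv]
      exact (hr s).le
  have hT0 : T 0 = 0 := by simp [hT]
  have hT1 : T 1 = 1 := by
    simp only [hT, hI', hcdef]
    rw [mul_one, add_sub_cancel, div_self hL0.ne']
  refine ⟨T, fun s => (σ s + c) / L, hTc, hT0, hT1, ?_, fun s hs => ⟨hTd s hs, hr s, ?_⟩⟩
  · intro s hs
    rw [← hT0, ← hT1]
    exact ⟨hmono ⟨le_rfl, zero_le_one⟩ hs hs.1, hmono hs ⟨zero_le_one, le_rfl⟩ hs.2⟩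
  · have h1 : L ^ 2 * ((σ s + c) / L) ^ 2 = (σ s + c) ^ 2 := by field_simp
    have h2 : σ s ^ 2 = (deriv x s ^ 2 + deriv v s ^ 2) / v s :=
      Real.sq_sqrt (div_nonneg (by positivity) (hc.pos s hs).le)
    rw [h1, ← h2]
    nlinarith [hσ0 s]

/-- Calibration. Let `h'' = -ω² h` and let `w` solve the Riccati equation `w' = -ω² - w²` on
`[0, 1]`. For `u = √v` the function
`4 ω x + 4 (h h' + 2 h' (u - h) + w (u - h)²)` of time and position grows along every curve at most
at the rate `L² T'`, where `T` is the time function of the curve. -/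
theorem IsCurve.sq_ge {p q : ℝ × ℝ} {x v : ℝ → ℝ} (hc : IsCurve p q x v) {L : ℝ}
    (hL : length x v < ENNReal.ofReal L) {h k w : ℝ → ℝ} {ω : ℝ}
    (hh : ∀ t, HasDerivAt h (k t) t) (hk : ∀ t, HasDerivAt k (-ω ^ 2 * h t) t)
    (hw : ∀ t ∈ Icc (0 : ℝ) 1, HasDerivAt w (-ω ^ 2 - w t ^ 2) t)
    (hp : √p.2 = h 0) (hq : √q.2 = h 1) :
    4 * ω * (q.1 - p.1) + 4 * (h 1 * k 1 - h 0 * k 0) ≤ L ^ 2 := by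
  obtain ⟨T, r, hTc, hT0, hT1, hmaps, hT⟩ := hc.exists_time hL
  set F : ℝ → ℝ := fun s => L ^ 2 * T s - (4 * ω * x s + 4 * (h (T s) * k (T s) +
    2 * (k (T s) * (√(v s) - h (T s))) + w (T s) * (√(v s) - h (T s)) ^ 2)) with hF
  have hhc : Continuous h := continuous_iff_continuousAt.2 fun t => (hh t).continuousAt
  have hkc : Continuous k := continuous_iff_continuousAt.2 fun t => (hk t).continuousAt
  have hwc : ContinuousOn w (Icc 0 1) := fun t ht => (hw t ht).continuousAt.continuousWithinAt
  have hFc : ContinuousOn F (Icc 0 1) := by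
    have h1 := hhc.comp_continuousOn hTc
    have h2 := hkc.comp_continuousOn hTc
    have h3 := hwc.comp hTc hmaps
    have h4 := hc.continuousOn_v.sqrt
    exact (continuousOn_const.mul hTc).sub ((continuousOn_const.mul hc.continuousOn_x).add
      (continuousOn_const.mul (((h1.mul h2).add (continuousOn_const.mul (h2.mul (h4.sub h1)))).add
        (h3.mul ((h4.sub h1).pow 2)))))
  have hFd : ∀ s ∈ Ioo (0 : ℝ) 1, ∃ d, 0 ≤ d ∧ HasDerivAt F d s := by
    intro s hs
    obtain ⟨hTd, hr, hsp⟩ := hT s hs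
    obtain ⟨hxd, hvd⟩ := hc.hasDerivAt hs
    have hv := hc.pos s hs
    have hu : 0 < √(v s) := Real.sqrt_pos.2 hv
    have h1 : HasDerivAt (fun s => h (T s)) (k (T s) * r s) s := (hh (T s)).comp s hTd
    have h2 : HasDerivAt (fun s => k (T s)) (-ω ^ 2 * h (T s) * r s) s := (hk (T s)).comp s hTd
    have h3 : HasDerivAt (fun s => w (T s)) ((-ω ^ 2 - w (T s) ^ 2) * r s) s :=
      (hw (T s) (hmaps (Ioo_subset_Icc_self hs))).comp s hTd
    have h4 := hvd.sqrt hv.ne'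
    have h5 := h4.sub h1
    have h6 := (hTd.const_mul (L ^ 2)).sub ((hxd.const_mul (4 * ω)).add
      ((((h1.mul h2).add ((h2.mul h5).const_mul 2)).add (h3.mul (h5.pow 2))).const_mul 4))
    refine ⟨_, ?_, h6⟩
    have hy : deriv x s = deriv x s / √(v s) * √(v s) := by field_simp
    have hspeed : 4 * (deriv v s / (2 * √(v s))) ^ 2 + (deriv x s / √(v s)) ^ 2 ≤
        L ^ 2 * r s ^ 2 := by
      refine le_of_eq_of_le ?_ hsp
      have := Real.sq_sqrt hv.le
      rw [div_pow, mul_pow, div_pow, this]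
      field_simp
      ring
    have key := calibration_deriv_nonneg (ω := ω) (h := h (T s)) (k := k (T s)) (w := w (T s))
      hr hy hspeed
    refine key.trans_eq ?_
    simp only [Pi.sub_apply, Pi.pow_apply, Nat.cast_ofNat]
    ring
  have hmono : MonotoneOn F (Icc 0 1) := by
    refine monotoneOn_of_deriv_nonneg (convex_Icc 0 1) hFc ?_ ?_ <;> rw [interior_Icc]
    · intro s hs
      obtain ⟨d, -, hd⟩ := hFd s hs
      exact hd.differentiableAt.differentiableWithinAt
    · intro s hs
      obtain ⟨d, hd0, hd⟩ := hFd s hs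
      rwa [hd.deriv]
  have h01 := hmono (left_mem_Icc.2 zero_le_one) (right_mem_Icc.2 zero_le_one) zero_le_one
  have e0 := hc.start
  have e1 := hc.finish
  subst e0 e1
  simp only at hp hq
  simp only [hF, hT0, hT1, hp, hq, sub_self] at h01
  linarith

/-! ### Geodesics -/

/-- If `h'' = -ω² h`, the curve `(X, h²)` with `X' = 2 ω h²` has constant speed `2 √(h'² + ω² h²)`,
and it is a shortest curve as soon as the Riccati equation has a solution on `[0, 1]`. -/
theorem dist_geodesic {h k w X : ℝ → ℝ} {ω : ℝ}
    (hh : ∀ t, HasDerivAt h (k t) t) (hk : ∀ t, HasDerivAt k (-ω ^ 2 * h t) t)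
    (hX : ∀ t, HasDerivAt X (2 * ω * h t ^ 2) t)
    (hw : ∀ t ∈ Icc (0 : ℝ) 1, HasDerivAt w (-ω ^ 2 - w t ^ 2) t)
    (hpos : ∀ t ∈ Ioo (0 : ℝ) 1, 0 < h t) (h0 : 0 ≤ h 0) (h1 : 0 ≤ h 1) :
    dist (X 0, h 0 ^ 2) (X 1, h 1 ^ 2) = 2 * √(k 0 ^ 2 + ω ^ 2 * h 0 ^ 2) := by
  set E := k 0 ^ 2 + ω ^ 2 * h 0 ^ 2 with hE
  have hE0 : 0 ≤ E := by positivity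
  have hEt : ∀ t, k t ^ 2 + ω ^ 2 * h t ^ 2 = E := by
    have hd : ∀ t, HasDerivAt (fun t => k t ^ 2 + ω ^ 2 * h t ^ 2) 0 t := fun t => by
      refine (((hk t).pow 2).add (((hh t).pow 2).const_mul (ω ^ 2))).congr_deriv ?_
      simp only [Nat.cast_ofNat]; ring
    exact fun t => is_const_of_deriv_eq_zero (fun t => (hd t).differentiableAt)
      (fun t => (hd t).deriv) t 0
  have hid : 4 * ω * (X 1 - X 0) + 4 * (h 1 * k 1 - h 0 * k 0) = 4 * E := by
    have hd : ∀ t, HasDerivAt (fun t => ω * X t + h t * k t - E * t) 0 t := fun t => by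
      refine ((((hX t).const_mul ω).add ((hh t).mul (hk t))).sub
        ((hasDerivAt_id t).const_mul E)).congr_deriv ?_
      rw [← hEt t]; ring
    have := is_const_of_deriv_eq_zero (fun t => (hd t).differentiableAt)
      (fun t => (hd t).deriv) 1 0
    linarith
  have hhd : ∀ t, HasDerivAt (fun t => h t ^ 2) (2 * h t * k t) t := fun t => by
    refine ((hh t).pow 2).congr_deriv ?_
    simp
  have hhc : Continuous h := continuous_iff_continuousAt.2 fun t => (hh t).continuousAt
  have hkc : Continuous k := continuous_iff_continuousAt.2 fun t => (hk t).continuousAt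
  have hXd : deriv X = fun t => 2 * ω * h t ^ 2 := funext fun t => (hX t).deriv
  have hvd : deriv (fun t => h t ^ 2) = fun t => 2 * h t * k t := funext fun t => (hhd t).deriv
  have hcX : ContDiff ℝ 1 X := contDiff_one_iff_deriv.2
    ⟨fun t => (hX t).differentiableAt, by rw [hXd]; fun_prop⟩
  have hcv : ContDiff ℝ 1 (fun t => h t ^ 2) := contDiff_one_iff_deriv.2
    ⟨fun t => (hhd t).differentiableAt, by rw [hvd]; fun_prop⟩
  have hcurve : IsCurve (X 0, h 0 ^ 2) (X 1, h 1 ^ 2) X (fun t => h t ^ 2) :=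
    ⟨hcX.continuous.continuousOn, hcv.continuous.continuousOn, hcX.contDiffOn, hcv.contDiffOn,
      fun t ht => pow_pos (hpos t ht) 2, rfl, rfl⟩
  have hlen : length X (fun t => h t ^ 2) = ENNReal.ofReal (2 * √E) := by
    have : ∀ t ∈ Ioo (0 : ℝ) 1, ENNReal.ofReal (√((deriv X t ^ 2 +
        deriv (fun t => h t ^ 2) t ^ 2) / h t ^ 2)) = ENNReal.ofReal (2 * √E) := by
      intro t ht
      have ht0 := (hpos t ht).ne'
      rw [hXd, hvd]
      congr 1
      have : ((2 * ω * h t ^ 2) ^ 2 + (2 * h t * k t) ^ 2) / h t ^ 2 = 2 ^ 2 * E := by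
        rw [← hEt t]; field_simp; ring
      simp only [this]
      rw [Real.sqrt_mul (by norm_num), Real.sqrt_sq (by norm_num)]
    rw [length, setLIntegral_congr_fun measurableSet_Ioo this]
    simp
  have hedist : edist (X 0, h 0 ^ 2) (X 1, h 1 ^ 2) = ENNReal.ofReal (2 * √E) := by
    refine le_antisymm ?_ ?_
    · rw [← hlen]
      exact iInf_le_of_le _ (iInf_le_of_le _ (iInf_le_of_le hcurve le_rfl))
    · refine le_iInf fun x => le_iInf fun v => le_iInf fun hc => ?_
      by_contra hlt
      obtain ⟨L, hL0, hL1, hL2⟩ := ENNReal.lt_iff_exists_real_btwn.1 (not_le.1 hlt)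
      have hsq := hc.sq_ge hL1 hh hk hw (Real.sqrt_sq h0) (Real.sqrt_sq h1)
      simp only [hid] at hsq
      have hL3 : L < 2 * √E := (ENNReal.ofReal_lt_ofReal_iff_of_nonneg hL0).1 hL2
      nlinarith [Real.sq_sqrt hE0, Real.sqrt_nonneg E]
  rw [dist, hedist, ENNReal.toReal_ofReal (by positivity)]

/-- The geodesic from `(0, 1)` to the point `(ψ (1 + S²) + 2 χ S, S²)` is a cycloid arc of opening
angle `θ`. -/
theorem dist_sq_div_two {θ S : ℝ} (hθ : θ ∈ Ioo 0 (2 * Real.pi)) (hS : 0 ≤ S) :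
    dist (0, 1) (psi θ * (1 + S ^ 2) + 2 * S * chi θ, S ^ 2) ^ 2 / 2 =
      θ ^ 2 / (1 - Real.cos θ) * (S ^ 2 + 1 - 2 * S * Real.cos (θ / 2)) := by
  have hs := sin_half_pos hθ
  rw [one_sub_cos_eq, psi_eq, chi]
  obtain ⟨δ, rfl⟩ : ∃ δ, θ = 2 * δ := ⟨θ / 2, by ring⟩
  rw [mul_div_cancel_left₀ δ two_ne_zero] at hs ⊢
  have hδ0 : 0 < δ := by linarith [hθ.1]
  have hδ1 : δ < Real.pi := by linarith [hθ.2]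
  set s := Real.sin δ with hs_def
  set c := Real.cos δ with hc_def
  have hlin : ∀ t, HasDerivAt (fun t : ℝ => δ * t) δ t := fun t => by
    simpa using (hasDerivAt_id t).const_mul δ
  have hlin' : ∀ t, HasDerivAt (fun t : ℝ => δ * (1 - t)) (-δ) t := fun t => by
    simpa using ((hasDerivAt_id t).const_sub 1).const_mul δ
  set h : ℝ → ℝ := fun t => (Real.sin (δ * (1 - t)) + S * Real.sin (δ * t)) / s with hh_def
  set k : ℝ → ℝ := fun t => δ * (S * Real.cos (δ * t) - Real.cos (δ * (1 - t))) / s with hk_def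
  have hh : ∀ t, HasDerivAt h (k t) t := fun t => by
    refine (((hlin' t).sin.add ((hlin t).sin.const_mul S)).div_const s).congr_deriv ?_
    simp only [hk_def]; ring
  have hk : ∀ t, HasDerivAt k (-δ ^ 2 * h t) t := fun t => by
    refine (((((hlin t).cos.const_mul S).sub (hlin' t).cos).const_mul δ).div_const s).congr_deriv ?_
    simp only [hh_def]; ring
  set E := δ ^ 2 * (1 + S ^ 2 - 2 * S * c) / s ^ 2 with hE
  have hEt : ∀ t, k t ^ 2 + δ ^ 2 * h t ^ 2 = E := by
    intro t
    have e1 := Real.sin_sq_add_cos_sq (δ * (1 - t))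
    have e2 := Real.sin_sq_add_cos_sq (δ * t)
    have e3 : c = Real.cos (δ * (1 - t)) * Real.cos (δ * t) -
        Real.sin (δ * (1 - t)) * Real.sin (δ * t) := by
      rw [← Real.cos_add, hc_def]; congr 1; ring
    simp only [hk_def, hh_def, hE, e3]
    field_simp
    linear_combination e1 + S ^ 2 * e2
  -- `(h h')' = E - 2 δ² h²`, which gives a primitive of `2 δ h²`
  set X : ℝ → ℝ := fun t => (E * t - h t * k t + h 0 * k 0) / δ with hX_def
  have hX : ∀ t, HasDerivAt X (2 * δ * h t ^ 2) t := fun t => by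
    refine (((((hasDerivAt_id t).const_mul E).sub ((hh t).mul (hk t))).add_const
      (h 0 * k 0)).div_const δ).congr_deriv ?_
    rw [← hEt t]; field_simp; ring
  have hw : ∀ t ∈ Icc (0 : ℝ) 1, HasDerivAt (fun t => -δ * Real.tan (δ * (t - 1 / 2)))
      (-δ ^ 2 - (-δ * Real.tan (δ * (t - 1 / 2))) ^ 2) t := by
    intro t ht
    have hcos : 0 < Real.cos (δ * (t - 1 / 2)) :=
      Real.cos_pos_of_mem_Ioo ⟨by nlinarith [ht.1], by nlinarith [ht.2]⟩
    have hl : HasDerivAt (fun t : ℝ => δ * (t - 1 / 2)) δ t := by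
      simpa only [mul_one] using! ((hasDerivAt_id t).sub_const (1 / 2)).const_mul δ
    have h1 : HasDerivAt (fun t => Real.tan (δ * (t - 1 / 2)))
        (1 / Real.cos (δ * (t - 1 / 2)) ^ 2 * δ) t :=
      HasDerivAt.comp (h₂ := Real.tan) t (Real.hasDerivAt_tan hcos.ne') hl
    refine (h1.const_mul (-δ)).congr_deriv ?_
    rw [Real.tan_eq_sin_div_cos]
    have := Real.sin_sq_add_cos_sq (δ * (t - 1 / 2))
    generalize δ * (t - 1 / 2) = y at *
    field_simp
    linear_combination this
  have hpos : ∀ t ∈ Ioo (0 : ℝ) 1, 0 < h t := by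
    intro t ht
    have h1 : 0 < Real.sin (δ * (1 - t)) :=
      Real.sin_pos_of_pos_of_lt_pi (mul_pos hδ0 (by linarith [ht.2])) (by nlinarith [ht.1])
    have h2 : 0 < Real.sin (δ * t) :=
      Real.sin_pos_of_pos_of_lt_pi (mul_pos hδ0 ht.1) (by nlinarith [ht.2])
    exact div_pos (by positivity) hs
  have v0 : h 0 = 1 := by simp [hh_def, ← hs_def, hs.ne']
  have v1 : h 1 = S := by simp [hh_def, ← hs_def, hs.ne']
  have w0 : k 0 = δ * (S - c) / s := by simp [hk_def, ← hc_def]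
  have w1 : k 1 = δ * (S * c - 1) / s := by simp [hk_def, ← hc_def]
  have X0 : X 0 = 0 := by simp [hX_def]
  have X1 : X 1 = (δ - s * c) / s ^ 2 * (1 + S ^ 2) + 2 * S * ((s - δ * c) / s ^ 2) := by
    simp only [hX_def, v0, v1, w0, w1, hE]
    field_simp
    ring
  have hd := dist_geodesic hh hk hX hw hpos (by rw [v0]; exact zero_le_one) (by rw [v1]; exact hS)
  rw [X0, X1, v0, v1, one_pow] at hd
  rw [hd, mul_pow, Real.sq_sqrt (by positivity)]
  have := hEt 0
  rw [v0] at this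
  simp only [one_pow] at this ⊢
  rw [this, hE]
  field_simp
  ring

/-- The vertical segment from `(0, 1)` to the origin is a geodesic. -/
theorem dist_zero_sq_div_two : dist (0, 1) (0, 0) ^ 2 / 2 = 2 := by
  have hd := dist_geodesic (h := fun t => 1 - t) (k := fun _ => -1) (w := fun _ => 0)
    (X := fun _ => 0) (ω := 0) (fun t => by simpa using (hasDerivAt_id t).const_sub 1)
    (fun t => by simpa using hasDerivAt_const t (-1 : ℝ))
    (fun t => by simpa using hasDerivAt_const t (0 : ℝ))
    (fun t _ => by simpa using hasDerivAt_const t (0 : ℝ))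
    (fun t ht => by linarith [ht.2]) (by norm_num) (by norm_num)
  norm_num at hd
  rw [hd]; norm_num

/-! ### End points of geodesics on a line -/

/-- The nonnegative roots of `a S² - 2 A S + b`, for `A < 0`. For `a = 0` the root is `b / (2 A)`. -/
theorem root_iff {a b A S : ℝ} (hA : A < 0) :
    (0 ≤ S ∧ a * S ^ 2 - 2 * A * S + b = 0) ↔
      (0 ≤ A ^ 2 - a * b ∧ b ≤ 0 ∧
        S = if a = 0 then b / (2 * A) else (A + √(A ^ 2 - a * b)) / a) ∨
      (0 ≤ A ^ 2 - a * b ∧ a < 0 ∧ S = (A - √(A ^ 2 - a * b)) / a) := by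
  constructor
  · rintro ⟨hS, h⟩
    have hsq : A ^ 2 - a * b = (a * S - A) ^ 2 := by linear_combination -a * h
    have hD : 0 ≤ A ^ 2 - a * b := hsq ▸ sq_nonneg _
    rw [hsq] at hD ⊢
    rcases le_or_gt 0 (a * S - A) with h1 | h1
    · refine Or.inl ⟨hD, by nlinarith, ?_⟩
      split_ifs with ha
      · subst ha
        rw [eq_div_iff (by linarith)]
        linarith
      · rw [Real.sqrt_sq h1, eq_div_iff ha]; ring
    · refine Or.inr ⟨hD, by nlinarith, ?_⟩
      rw [← neg_sq, Real.sqrt_sq (by linarith), eq_div_iff (by nlinarith)]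
      ring
  · rintro (⟨hD, hb, h⟩ | ⟨hD, ha, h⟩)
    · split_ifs at h with ha
      · subst ha h
        refine ⟨div_nonneg_of_nonpos hb (by linarith), ?_⟩
        have := hA.ne
        field_simp
        ring
      · set r := √(A ^ 2 - a * b) with hr
        have hr0 : 0 ≤ r := Real.sqrt_nonneg _
        have hr2 : r ^ 2 = A ^ 2 - a * b := Real.sq_sqrt hD
        have hSr : a * S = A + r := by rw [h, mul_div_cancel₀ _ ha]
        constructor
        · rw [h]
          rcases lt_or_gt_of_ne ha with ha | ha
          · refine div_nonneg_of_nonpos ?_ ha.le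
            nlinarith
          · refine div_nonneg ?_ ha.le
            nlinarith
        · refine mul_left_cancel₀ ha ?_
          linear_combination (a * S - A + r) * hSr + hr2
    · set r := √(A ^ 2 - a * b) with hr
      have hr0 : 0 ≤ r := Real.sqrt_nonneg _
      have hr2 : r ^ 2 = A ^ 2 - a * b := Real.sq_sqrt hD
      have hSr : a * S = A - r := by rw [h, mul_div_cancel₀ _ ha.ne]
      constructor
      · rw [h]
        exact div_nonneg_of_nonpos (by linarith) ha.le
      · refine mul_left_cancel₀ ha.ne ?_
        linear_combination (a * S - A - r) * hSr + hr2

theorem A_neg {θ : ℝ} (h : θ ∈ Ioo 0 (2 * Real.pi)) : A θ < 0 := by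
  have h1 := psi_mul_A h
  have h2 := psi_pos h
  have h3 := chi_pos h
  by_contra h4
  have := mul_nonneg h2.le (not_lt.1 h4)
  linarith

theorem one_sub_mul_B {θ : ℝ} (h : θ ∈ Ioo 0 (2 * Real.pi)) (β : ℝ) :
    psi θ * (1 - β * B θ) = psi θ - β := by
  linear_combination -β * psi_mul_B h

theorem one_sub_mul_B_nonpos_iff {θ β : ℝ} (hβ : 0 < β) (h : θ ∈ Ioo 0 (2 * Real.pi)) :
    1 - β * B θ ≤ 0 ↔ θ ≤ psiInv β := by
  rw [le_psiInv_iff hβ h, ← sub_nonpos (a := psi θ), ← one_sub_mul_B h β,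
    ← neg_nonneg, ← neg_nonneg (a := psi θ * _), ← mul_neg]
  exact (mul_nonneg_iff_of_pos_left (psi_pos h)).symm

theorem one_sub_mul_B_neg_iff {θ β : ℝ} (hβ : 0 < β) (h : θ ∈ Ioo 0 (2 * Real.pi)) :
    1 - β * B θ < 0 ↔ θ < psiInv β := by
  rw [lt_psiInv_iff hβ h, ← sub_neg (a := psi θ), ← one_sub_mul_B h β,
    ← neg_pos, ← neg_pos (a := psi θ * _), ← mul_neg]
  exact (mul_pos_iff_of_pos_left (psi_pos h)).symm

theorem psi_sq_mul_disc {θ : ℝ} (h : θ ∈ Ioo 0 (2 * Real.pi)) (β γ : ℝ) :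
    psi θ ^ 2 * disc β γ θ = chi θ ^ 2 - (psi θ - γ) * (psi θ - β) := by
  rw [disc, ← one_sub_mul_B h β, ← one_sub_mul_B h γ, ← neg_sq (chi θ), ← psi_mul_A h]
  ring

theorem disc_nonneg_iff {θ : ℝ} (h : θ ∈ Ioo 0 (2 * Real.pi)) (β γ : ℝ) :
    0 ≤ disc β γ θ ↔ (psi θ - γ) * (psi θ - β) ≤ chi θ ^ 2 := by
  rw [← sub_nonneg (b := (psi θ - γ) * (psi θ - β)), ← psi_sq_mul_disc h]
  exact (mul_nonneg_iff_of_pos_left (pow_pos (psi_pos h) 2)).symm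

/-- The end points of geodesics with opening angle `θ` on the line `L_{β,γ}`. -/
theorem endpoint_mem_line_iff {θ S β γ : ℝ} (h : θ ∈ Ioo 0 (2 * Real.pi)) :
    (0 ≤ S ∧ psi θ * (1 + S ^ 2) + 2 * S * chi θ = β + γ * S ^ 2) ↔
      (0 ≤ disc β γ θ ∧ 1 - β * B θ ≤ 0 ∧ S = SPlus β γ θ) ∨
      (0 ≤ disc β γ θ ∧ 1 - γ * B θ < 0 ∧ S = SMinus β γ θ) := by
  rw [SPlus, SMinus, disc, ← root_iff (A_neg h)]
  refine and_congr_right fun _ => ?_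
  have e : psi θ * ((1 - γ * B θ) * S ^ 2 - 2 * A θ * S + (1 - β * B θ)) =
      psi θ * (1 + S ^ 2) + 2 * S * chi θ - (β + γ * S ^ 2) := by
    linear_combination S ^ 2 * one_sub_mul_B h γ + one_sub_mul_B h β - 2 * S * psi_mul_A h
  rw [← sub_eq_zero, ← e, mul_eq_zero, or_iff_right (psi_pos h).ne']

theorem dist_eq_LambdaPlus {θ β γ : ℝ} (h : θ ∈ Ioo 0 (2 * Real.pi)) (hD : 0 ≤ disc β γ θ)
    (hb : 1 - β * B θ ≤ 0) : ∃ p ∈ line β γ, dist (0, 1) p ^ 2 / 2 = LambdaPlus β γ θ := by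
  obtain ⟨hS, he⟩ := (endpoint_mem_line_iff h).2 (Or.inl ⟨hD, hb, rfl⟩)
  exact ⟨_, ⟨sq_nonneg _, he⟩, dist_sq_div_two h hS⟩

theorem dist_eq_LambdaMinus {θ β γ : ℝ} (h : θ ∈ Ioo 0 (2 * Real.pi)) (hD : 0 ≤ disc β γ θ)
    (ha : 1 - γ * B θ < 0) : ∃ p ∈ line β γ, dist (0, 1) p ^ 2 / 2 = LambdaMinus β γ θ := by
  obtain ⟨hS, he⟩ := (endpoint_mem_line_iff h).2 (Or.inr ⟨hD, ha, rfl⟩)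
  refine ⟨(_, SMinus β γ θ ^ 2), ⟨sq_nonneg _, he⟩, ?_⟩
  rw [dist_sq_div_two h hS, LambdaMinus, if_neg h.1.ne']

/-- Every point to the right of the line `x = 0` is the end point of a geodesic arc from `(0, 1)`
with opening angle in `(0, 2π)`; the angle is a root of `endpoint_mem_line_iff`. -/
theorem exists_angle {p : ℝ × ℝ} {β γ : ℝ} (hp : p ∈ line β γ) (hx : 0 < p.1) :
    ∃ θ ∈ Ioo 0 (2 * Real.pi), 0 ≤ disc β γ θ ∧
      ((1 - β * B θ ≤ 0 ∧ dist (0, 1) p ^ 2 / 2 = LambdaPlus β γ θ) ∨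
        (1 - γ * B θ < 0 ∧ dist (0, 1) p ^ 2 / 2 = LambdaMinus β γ θ)) := by
  have hS : 0 ≤ √p.2 := Real.sqrt_nonneg _
  have hS2 : √p.2 ^ 2 = p.2 := Real.sq_sqrt hp.1
  obtain ⟨θ, hθ, he⟩ := (bijOn_psi_add_chi (a := 1 + √p.2 ^ 2) (b := 2 * √p.2) (by positivity)
    (by positivity)).surjOn hx
  simp only at he
  rw [mul_comm] at he
  have hd := dist_sq_div_two hθ hS
  rw [he, hS2, Prod.mk.eta] at hd
  have hl : psi θ * (1 + √p.2 ^ 2) + 2 * √p.2 * chi θ = β + γ * √p.2 ^ 2 := by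
    rw [he, hp.2, hS2]
  refine ⟨θ, hθ, ?_⟩
  rcases (endpoint_mem_line_iff hθ).1 ⟨hS, hl⟩ with ⟨h1, h2, h3⟩ | ⟨h1, h2, h3⟩
  · refine ⟨h1, Or.inl ⟨h2, ?_⟩⟩
    rw [hd, LambdaPlus, ← h3, hS2]
  · refine ⟨h1, Or.inr ⟨h2, ?_⟩⟩
    rw [hd, LambdaMinus, if_neg hθ.1.ne', ← h3, hS2]

theorem image_line_eq {β γ : ℝ} (hβ : 0 < β) (hγ : 0 < γ) :
    (fun p => dist (0, 1) p ^ 2 / 2) '' line β γ =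
      LambdaPlus β γ '' {θ | θ ∈ Ioo 0 (2 * Real.pi) ∧ 0 ≤ disc β γ θ ∧ θ ≤ psiInv β} ∪
      LambdaMinus β γ '' {θ | θ ∈ Ioo 0 (2 * Real.pi) ∧ 0 ≤ disc β γ θ ∧ θ < psiInv γ} := by
  ext y
  constructor
  · rintro ⟨p, hp, rfl⟩
    have hx : 0 < p.1 := by rw [hp.2]; nlinarith [mul_nonneg hγ.le hp.1]
    obtain ⟨θ, hθ, hD, ⟨h1, h2⟩ | ⟨h1, h2⟩⟩ := exists_angle hp hx
    · exact Or.inl ⟨θ, ⟨hθ, hD, (one_sub_mul_B_nonpos_iff hβ hθ).1 h1⟩, h2.symm⟩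
    · exact Or.inr ⟨θ, ⟨hθ, hD, (one_sub_mul_B_neg_iff hγ hθ).1 h1⟩, h2.symm⟩
  · rintro (⟨θ, ⟨hθ, hD, h1⟩, rfl⟩ | ⟨θ, ⟨hθ, hD, h1⟩, rfl⟩)
    · exact dist_eq_LambdaPlus hθ hD ((one_sub_mul_B_nonpos_iff hβ hθ).2 h1)
    · exact dist_eq_LambdaMinus hθ hD ((one_sub_mul_B_neg_iff hγ hθ).2 h1)

theorem disc_zero_nonneg {γ θ : ℝ} (hγ : 0 < γ) (h : θ ∈ Ioo 0 (psiInv γ)) :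
    0 ≤ disc 0 γ θ := by
  have h' := Ioo_psiInv_subset hγ h
  rw [disc_nonneg_iff h']
  have := (lt_psiInv_iff hγ h').1 h.2
  nlinarith [psi_pos h', sq_nonneg (chi θ)]

/-- For `β = 0` the origin lies on the line, and there is no root `S⁺`. -/
theorem image_line_zero_eq {γ : ℝ} (hγ : 0 < γ) :
    (fun p => dist (0, 1) p ^ 2 / 2) '' line 0 γ = LambdaMinus 0 γ '' Ico 0 (psiInv γ) := by
  have h02 : dist (0, 1) (0, 0) ^ 2 / 2 = LambdaMinus 0 γ 0 := by
    rw [dist_zero_sq_div_two, LambdaMinus, if_pos rfl]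
  ext y
  constructor
  · rintro ⟨p, hp, rfl⟩
    rcases hp.1.eq_or_lt with h0 | h0
    · refine ⟨0, ⟨le_rfl, (psiInv_mem hγ).1⟩, ?_⟩
      have : p = (0, 0) := Prod.ext (by rw [hp.2, ← h0]; simp) h0.symm
      rw [this]; exact h02.symm
    · have hx : 0 < p.1 := by rw [hp.2]; nlinarith [mul_pos hγ h0]
      obtain ⟨θ, hθ, hD, ⟨h1, h2⟩ | ⟨h1, h2⟩⟩ := exists_angle hp hx
      · norm_num at h1
      · exact ⟨θ, ⟨hθ.1.le, (one_sub_mul_B_neg_iff hγ hθ).1 h1⟩, h2.symm⟩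
  · rintro ⟨θ, hθ, rfl⟩
    rcases hθ.1.eq_or_lt with h0 | h0
    · exact ⟨(0, 0), ⟨le_rfl, by simp⟩, by rw [← h0]; exact h02⟩
    · have hθ' := Ioo_psiInv_subset hγ ⟨h0, hθ.2⟩
      exact dist_eq_LambdaMinus hθ' (disc_zero_nonneg hγ ⟨h0, hθ.2⟩)
        ((one_sub_mul_B_neg_iff hγ hθ').2 hθ.2)

/-! ### The angles with a nonnegative discriminant -/

theorem disc_self_nonneg_iff {β θ : ℝ} (hβ : 0 < β) (h : θ ∈ Ioo 0 (2 * Real.pi))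
    (hle : θ ≤ psiInv β) : 0 ≤ disc β β θ ↔ etaInv β ≤ θ := by
  rw [disc_nonneg_iff h, etaInv_le_iff hβ h]
  have h1 := (le_psiInv_iff hβ h).1 hle
  have h2 := chi_pos h
  rw [← sq, sq_le_sq, abs_of_nonpos (by linarith), abs_of_pos h2]
  constructor <;> intro <;> linarith

/-- Here `α` is the larger and `δ` the smaller of the two parameters of the line. -/
theorem mul_sub_le_chi_sq_iff {α δ θ : ℝ} (hα : 0 < α) (hδ : 0 < δ) (h : θ ∈ Ioo 0 (psiInv α)) :
    (psi θ - α) * (psi θ - δ) ≤ chi θ ^ 2 ↔ etaSubInv α δ ≤ θ := by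
  have h' := Ioo_psiInv_subset hα h
  have h1 := (lt_psiInv_iff hα h').1 h.2
  rw [etaSubInv_le_iff hα hδ h, ← sub_le_iff_le_add, le_div_iff₀ (by linarith)]
  constructor <;> intro <;> linarith

theorem disc_comm (β γ θ : ℝ) : disc β γ θ = disc γ β θ := by
  rw [disc, disc]; ring

theorem disc_nonneg_iff_of_lt {α δ θ : ℝ} (hδ : 0 < δ) (hlt : δ < α)
    (h : θ ∈ Ioo 0 (2 * Real.pi)) (hle : θ ≤ psiInv α) :
    0 ≤ disc δ α θ ↔ etaSubInv α δ ≤ θ := by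
  have hα := hδ.trans hlt
  rcases hle.eq_or_lt with he | he
  · refine iff_of_true ?_ ?_
    · rw [disc_nonneg_iff h, he, psi_psiInv hα, sub_self, zero_mul]
      exact sq_nonneg _
    · rw [he]; exact (etaSubInv_mem hα hδ).2.le
  · rw [disc_nonneg_iff h, mul_sub_le_chi_sq_iff hα hδ ⟨h.1, he⟩]

theorem LambdaPlus_nonneg {β γ θ : ℝ} : 0 ≤ LambdaPlus β γ θ := by
  refine mul_nonneg (div_nonneg (sq_nonneg _) (by linarith [Real.cos_le_one θ])) ?_
  nlinarith [sq_nonneg (SPlus β γ θ - Real.cos (θ / 2)), Real.sin_sq_add_cos_sq (θ / 2),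
    sq_nonneg (Real.sin (θ / 2))]

theorem LambdaMinus_nonneg {β γ θ : ℝ} : 0 ≤ LambdaMinus β γ θ := by
  rw [LambdaMinus]
  split_ifs
  · norm_num
  refine mul_nonneg (div_nonneg (sq_nonneg _) (by linarith [Real.cos_le_one θ])) ?_
  nlinarith [sq_nonneg (SMinus β γ θ - Real.cos (θ / 2)), Real.sin_sq_add_cos_sq (θ / 2),
    sq_nonneg (Real.sin (θ / 2))]

/-- If `Δ ≥ 0` is equivalent to `m ≤ θ` on the relevant angles, then `D_{β,γ}` is the minimum of
the infima of `Λ^±` over the intervals that start at `m`. -/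
theorem D_eq_min {β γ m : ℝ} (hβ : 0 < β) (hγ : 0 < γ) (hm : 0 < m) (hmβ : m ≤ psiInv β)
    (hmγ : m < psiInv γ) (hdisc : ∀ θ ∈ Ioo 0 (2 * Real.pi),
      θ ≤ max (psiInv β) (psiInv γ) → (0 ≤ disc β γ θ ↔ m ≤ θ)) :
    D β γ = min (sInf (LambdaPlus β γ '' Icc m (psiInv β)))
      (sInf (LambdaMinus β γ '' Ico m (psiInv γ))) := by
  have e1 : {θ | θ ∈ Ioo 0 (2 * Real.pi) ∧ 0 ≤ disc β γ θ ∧ θ ≤ psiInv β} =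
      Icc m (psiInv β) := by
    ext θ
    constructor
    · rintro ⟨h, hD, hle⟩
      exact ⟨(hdisc θ h (hle.trans (le_max_left _ _))).1 hD, hle⟩
    · rintro ⟨h1, h2⟩
      have h : θ ∈ Ioo 0 (2 * Real.pi) := ⟨hm.trans_le h1, h2.trans_lt (psiInv_mem hβ).2⟩
      exact ⟨h, (hdisc θ h (h2.trans (le_max_left _ _))).2 h1, h2⟩
  have e2 : {θ | θ ∈ Ioo 0 (2 * Real.pi) ∧ 0 ≤ disc β γ θ ∧ θ < psiInv γ} =
      Ico m (psiInv γ) := by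
    ext θ
    constructor
    · rintro ⟨h, hD, hlt⟩
      exact ⟨(hdisc θ h (hlt.le.trans (le_max_right _ _))).1 hD, hlt⟩
    · rintro ⟨h1, h2⟩
      have h : θ ∈ Ioo 0 (2 * Real.pi) := ⟨hm.trans_le h1, h2.trans (psiInv_mem hγ).2⟩
      exact ⟨h, (hdisc θ h (h2.le.trans (le_max_right _ _))).2 h1, h2⟩
  rw [D, image_line_eq hβ hγ, e1, e2]
  refine csInf_union ⟨0, ?_⟩ ((nonempty_Icc.2 hmβ).image _) ⟨0, ?_⟩ ((nonempty_Ico.2 hmγ).image _)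
  · rintro _ ⟨θ, -, rfl⟩; exact LambdaPlus_nonneg
  · rintro _ ⟨θ, -, rfl⟩; exact LambdaMinus_nonneg

/-! ### The limits at the ends of the intervals -/

theorem continuousAt_A {θ : ℝ} (h : θ ∈ Ioo 0 (2 * Real.pi)) : ContinuousAt A θ := by
  have h1 := (sub_sin_pos h.1).ne'
  unfold A
  fun_prop (disch := assumption)

theorem continuousAt_B {θ : ℝ} (h : θ ∈ Ioo 0 (2 * Real.pi)) : ContinuousAt B θ := by
  have h1 := (sub_sin_pos h.1).ne'
  unfold B
  fun_prop (disch := assumption)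

theorem continuousAt_disc (β γ : ℝ) {θ : ℝ} (h : θ ∈ Ioo 0 (2 * Real.pi)) :
    ContinuousAt (disc β γ) θ :=
  ((continuousAt_A h).pow 2).sub ((continuousAt_const.sub
    (continuousAt_const.mul (continuousAt_B h))).mul
    (continuousAt_const.sub (continuousAt_const.mul (continuousAt_B h))))

/-- Rationalizing the numerator removes the singularity of `S⁺` at `ψ⁻¹(γ)`. -/
theorem SPlus_eq {β γ θ : ℝ} (h : θ ∈ Ioo 0 (2 * Real.pi)) (hD : 0 ≤ disc β γ θ) :
    SPlus β γ θ = (1 - β * B θ) / (A θ - √(disc β γ θ)) := by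
  have hA := A_neg h
  have hr := Real.sqrt_nonneg (disc β γ θ)
  rw [SPlus]
  split_ifs with ha
  · have : disc β γ θ = (-A θ) ^ 2 := by rw [disc, ha]; ring
    rw [this, Real.sqrt_sq (by linarith)]
    congr 1; ring
  · rw [div_eq_div_iff ha (by linarith)]
    have := Real.sq_sqrt hD
    have e : disc β γ θ = A θ ^ 2 - (1 - γ * B θ) * (1 - β * B θ) := rfl
    linear_combination -this - e

theorem tendsto_LambdaPlus {β γ : ℝ} (hγ : 0 < γ) :
    Tendsto (LambdaPlus β γ) (𝓝[<] (psiInv γ)) (𝓝 (LambdaPlus β γ (psiInv γ))) := by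
  have hp := psiInv_mem hγ
  have ha : 1 - γ * B (psiInv γ) = 0 := by
    have := one_sub_mul_B hp γ
    rw [psi_psiInv hγ, sub_self, mul_eq_zero] at this
    exact this.resolve_left hγ.ne'
  have hD : 0 < disc β γ (psiInv γ) := by
    rw [disc, ha, zero_mul, sub_zero]
    exact sq_pos_of_neg (A_neg hp)
  have hev : ∀ᶠ θ in 𝓝 (psiInv γ), θ ∈ Ioo 0 (2 * Real.pi) ∧ 0 < disc β γ θ :=
    (eventually_mem_set.2 (isOpen_Ioo.mem_nhds hp)).and
      ((continuousAt_disc β γ hp).eventually_const_lt hD)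
  have hS : ContinuousAt (SPlus β γ) (psiInv γ) := by
    have hc : ContinuousAt (fun θ => (1 - β * B θ) / (A θ - √(disc β γ θ))) (psiInv γ) :=
      (continuousAt_const.sub (continuousAt_const.mul (continuousAt_B hp))).div
        ((continuousAt_A hp).sub (continuousAt_disc β γ hp).sqrt)
        (by linarith [A_neg hp, Real.sqrt_nonneg (disc β γ (psiInv γ))] : _ < (0 : ℝ)).ne
    refine hc.congr ?_
    filter_upwards [hev] with θ h
    exact (SPlus_eq h.1 h.2.le).symm
  have h1 := (one_sub_cos_pos hp).ne'
  have hL : ContinuousAt (LambdaPlus β γ) (psiInv γ) := by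
    unfold LambdaPlus
    fun_prop (disch := assumption)
  exact hL.tendsto.mono_left nhdsWithin_le_nhds

theorem tendsto_sq_div_one_sub_cos :
    Tendsto (fun θ : ℝ => θ ^ 2 / (1 - Real.cos θ)) (𝓝[>] 0) (𝓝 2) := by
  have h : Tendsto (fun θ : ℝ => 2 / Real.sinc (θ / 2) ^ 2) (𝓝 0) (𝓝 (2 / Real.sinc (0 / 2) ^ 2)) :=
    ContinuousAt.tendsto (ContinuousAt.div continuousAt_const
      ((Real.continuous_sinc.comp (continuous_id.div_const 2)).pow 2).continuousAt (by simp))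
  rw [zero_div, Real.sinc_zero, one_pow, div_one] at h
  refine (h.mono_left nhdsWithin_le_nhds).congr' ?_
  filter_upwards [Ioo_mem_nhdsGT Real.two_pi_pos] with θ hθ
  have h0 : θ ≠ 0 := hθ.1.ne'
  have hs := (sin_half_pos hθ).ne'
  rw [one_sub_cos_eq, Real.sinc_of_ne_zero (by positivity)]
  field_simp

theorem SMinus_eq {β γ θ : ℝ} (h : θ ∈ Ioo 0 (2 * Real.pi)) :
    SMinus β γ θ =
      (-chi θ - √(chi θ ^ 2 - (psi θ - γ) * (psi θ - β))) / (psi θ - γ) := by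
  have hp := psi_pos h
  rw [← psi_sq_mul_disc h, Real.sqrt_mul (sq_nonneg _), Real.sqrt_sq hp.le, ← psi_mul_A h,
    ← one_sub_mul_B h γ, ← mul_sub, mul_div_mul_left _ _ hp.ne', SMinus]

theorem tendsto_LambdaMinus_zero {γ : ℝ} (hγ : 0 < γ) :
    Tendsto (LambdaMinus 0 γ) (𝓝[>] 0) (𝓝 (LambdaMinus 0 γ 0)) := by
  have hS : Tendsto (SMinus 0 γ) (𝓝[>] 0) (𝓝 0) := by
    have h1 := tendsto_psi_zero
    have h2 := tendsto_chi_zero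
    have h3 := (h2.neg.sub ((h2.pow 2).sub ((h1.sub_const γ).mul (h1.sub_const 0))).sqrt).div
      (h1.sub_const γ) (by simpa using hγ.ne')
    simp only [neg_zero, zero_pow two_ne_zero, sub_zero, mul_zero, Real.sqrt_zero, zero_div] at h3
    refine h3.congr' ?_
    filter_upwards [Ioo_mem_nhdsGT Real.two_pi_pos] with θ hθ
    rw [SMinus_eq hθ, sub_zero, Pi.div_apply]
  have hcos : Tendsto (fun θ : ℝ => Real.cos (θ / 2)) (𝓝[>] 0) (𝓝 (Real.cos (0 / 2))) :=
    (Continuous.tendsto (by fun_prop) _).mono_left nhdsWithin_le_nhds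
  have h := tendsto_sq_div_one_sub_cos.mul
    (((hS.pow 2).add_const 1).sub ((hS.const_mul 2).mul hcos))
  norm_num at h
  rw [LambdaMinus, if_pos rfl]
  refine h.congr' ?_
  filter_upwards [self_mem_nhdsWithin] with θ hθ
  rw [LambdaMinus, if_neg (ne_of_gt hθ)]

end Heston

theorem theorem3 :
    -- the inverse functions `ψ⁻¹`, `η⁻¹`, `η_α⁻¹` exist on `(0, ∞)`
    BijOn Heston.psi (Ioo 0 (2 * Real.pi)) (Ioi 0) ∧
    BijOn Heston.eta (Ioo 0 (2 * Real.pi)) (Ioi 0) ∧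
    (∀ α : ℝ, 0 < α → BijOn (Heston.etaSub α) (Ioo 0 (Heston.psiInv α)) (Ioi 0)) ∧
    -- the values of `Λ⁺` at `ψ⁻¹(γ)` and of `Λ⁻_{0,γ}` at `0` are limits
    (∀ β γ : ℝ, 0 ≤ β → 0 < γ →
      Tendsto (Heston.LambdaPlus β γ) (𝓝[<] (Heston.psiInv γ))
        (𝓝 (Heston.LambdaPlus β γ (Heston.psiInv γ)))) ∧
    (∀ γ : ℝ, 0 < γ →
      Tendsto (Heston.LambdaMinus 0 γ) (𝓝[>] 0) (𝓝 (Heston.LambdaMinus 0 γ 0))) ∧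
    -- 1) `γ = β > 0`
    (∀ β : ℝ, 0 < β →
      Heston.etaInv β < Heston.psiInv β ∧
      (∀ θ ∈ Icc (Heston.etaInv β) (Heston.psiInv β), 0 ≤ Heston.disc β β θ) ∧
      Heston.D β β =
        min (sInf (Heston.LambdaPlus β β '' Icc (Heston.etaInv β) (Heston.psiInv β)))
          (sInf (Heston.LambdaMinus β β '' Ico (Heston.etaInv β) (Heston.psiInv β)))) ∧
    -- 2) `γ > β > 0`
    (∀ β γ : ℝ, 0 < β → β < γ →
      Heston.etaSubInv γ β < Heston.psiInv β ∧ Heston.psiInv β < Heston.psiInv γ ∧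
      (∀ θ ∈ Ico (Heston.etaSubInv γ β) (Heston.psiInv γ), 0 ≤ Heston.disc β γ θ) ∧
      Heston.D β γ =
        min (sInf (Heston.LambdaPlus β γ '' Icc (Heston.etaSubInv γ β) (Heston.psiInv β)))
          (sInf (Heston.LambdaMinus β γ '' Ico (Heston.etaSubInv γ β) (Heston.psiInv γ)))) ∧
    -- 3) `β = 0`, `γ > 0`
    (∀ γ : ℝ, 0 < γ →
      0 < Heston.psiInv γ ∧
      (∀ θ ∈ Ioo 0 (Heston.psiInv γ), 0 ≤ Heston.disc 0 γ θ) ∧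
      Heston.D 0 γ = sInf (Heston.LambdaMinus 0 γ '' Ico 0 (Heston.psiInv γ))) ∧
    -- 4) `β > γ > 0`
    (∀ β γ : ℝ, 0 < γ → γ < β →
      Heston.etaSubInv β γ < Heston.psiInv γ ∧ Heston.psiInv γ < Heston.psiInv β ∧
      (∀ θ ∈ Icc (Heston.etaSubInv β γ) (Heston.psiInv β), 0 ≤ Heston.disc β γ θ) ∧
      Heston.D β γ =
        min (sInf (Heston.LambdaPlus β γ '' Icc (Heston.etaSubInv β γ) (Heston.psiInv β)))
          (sInf (Heston.LambdaMinus β γ '' Ico (Heston.etaSubInv β γ) (Heston.psiInv γ)))) := by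
  refine ⟨Heston.bijOn_psi, Heston.bijOn_eta, fun α hα => Heston.bijOn_etaSub hα,
    fun β γ _ hγ => Heston.tendsto_LambdaPlus hγ, fun γ hγ => Heston.tendsto_LambdaMinus_zero hγ,
    ?_, ?_, ?_, ?_⟩
  · intro β hβ
    have hm := Heston.etaInv_mem hβ
    have hlt := Heston.etaInv_lt_psiInv hβ
    refine ⟨hlt, fun θ hθ => ?_, ?_⟩
    · exact (Heston.disc_self_nonneg_iff hβ ⟨hm.1.trans_le hθ.1,
        hθ.2.trans_lt (Heston.psiInv_mem hβ).2⟩ hθ.2).2 hθ.1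
    · refine Heston.D_eq_min hβ hβ hm.1 hlt.le hlt fun θ h hle => ?_
      rw [max_self] at hle
      exact Heston.disc_self_nonneg_iff hβ h hle
  · intro β γ hβ hlt
    have hγ := hβ.trans hlt
    have hm := Heston.etaSubInv_mem hγ hβ
    have h1 := Heston.etaSubInv_lt_psiInv hγ hβ
    have h2 := Heston.psiInv_lt_psiInv hβ hlt
    refine ⟨h1, h2, fun θ hθ => ?_, ?_⟩
    · exact (Heston.disc_nonneg_iff_of_lt hβ hlt ⟨hm.1.trans_le hθ.1,
        hθ.2.trans (Heston.psiInv_mem hγ).2⟩ hθ.2.le).2 hθ.1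
    · refine Heston.D_eq_min hβ hγ hm.1 h1.le hm.2 fun θ h hle => ?_
      rw [max_eq_right h2.le] at hle
      exact Heston.disc_nonneg_iff_of_lt hβ hlt h hle
  · intro γ hγ
    refine ⟨(Heston.psiInv_mem hγ).1, fun θ hθ => ?_, ?_⟩
    · exact Heston.disc_zero_nonneg hγ hθ
    · rw [Heston.D, Heston.image_line_zero_eq hγ]
  · intro β γ hγ hlt
    have hβ := hγ.trans hlt
    have hm := Heston.etaSubInv_mem hβ hγ
    have h1 := Heston.etaSubInv_lt_psiInv hβ hγ
    have h2 := Heston.psiInv_lt_psiInv hγ hlt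
    refine ⟨h1, h2, fun θ hθ => ?_, ?_⟩
    · rw [Heston.disc_comm]
      exact (Heston.disc_nonneg_iff_of_lt hγ hlt ⟨hm.1.trans_le hθ.1,
        hθ.2.trans_lt (Heston.psiInv_mem hβ).2⟩ hθ.2).2 hθ.1
    · refine Heston.D_eq_min hβ hγ hm.1 hm.2.le h1 fun θ h hle => ?_
      rw [max_eq_left h2.le] at hle
      rw [Heston.disc_comm]
      exact Heston.disc_nonneg_iff_of_lt hγ hlt h hle
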